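/- **Theorem (general quadratic algebras).** Let $k$ be a field, $n\ge 0$, $V$ a $k$-vector space with basis $x_1,\dots,x_n$, $T(V)$ its tensor algebra, $S(V)=k[x_1,\dots,x_n]$ its symmetric algebra and $\hbar$ a formal parameter. Let $\alpha_{ij}^{ab}\in k$ ($1\le i,j,a,b\le n$) satisfy $\alpha_{ij}^{ab}=-\alpha_{ji}^{ab}$ and $\alpha_{ii}^{ab}=0$ (the latter follows from the former if $\operatorname{char} k\neq 2$); no symmetry in $a,b$ is assumed. Put $$\varphi_{ij}=\hbar\sum_{a,b}\alpha_{ij}^{ab}\,x_a\otimes x_b\in T(V)[\hbar],\qquad A=T(V)[\hbar]\big/\big(x_i\otimes x_j-x_j\otimes x_i-\varphi_{ij}\big)_{1\le i<j\le n}.$$ Suppose that for all $i,j,k,b,c,d\in\{1,\dots,n\}$ $$\operatorname{Cycl}_{i,j,k}\sum_{s}\left(\alpha_{jk}^{sb}\alpha_{is}^{cd}+\alpha_{jk}^{cs}\alpha_{is}^{db}\right)=0,$$ where $\operatorname{Cycl}_{i,j,k}$ is the sum over the three cyclic permutations of $(i,j,k)$. Then: 1. $A$ has the PBW-like property for the descending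 filtration $\Gamma_\ell=\hbar^\ell A$, $\ell\ge 0$: there is an isomorphism of graded $k[\hbar]$-algebras $$\bigoplus_{\ell\ge 0}\Gamma_\ell/\Gamma_{\ell+1}\simeq S(V)[\hbar]$$ which identifies $\Gamma_\ell/\Gamma_{\ell+1}$ with $\hbar^\ell S(V)$ for every $\ell$. (Here both sides are graded by powers of $\hbar$, and $\hbar$ acts on the left-hand side as multiplication by its class in $\Gamma_1/\Gamma_2$.) 2. For generic $a\in k$ the specialization $A_a=A\otimes_{k[\hbar]}k[\hbar]/(\hbar-a)$ is a PBW algebra. Precisely, let $\mathscr S\subset k$ be the set of all $a\in k$ for which the prime ideal $(\hbar-a)$ lies in the support of the $k[\hbar]$-module $\bigcap_{\ell\ge0}\Gamma_\ell$. Then $\mathscr S$ is at most countable, and for every $a\in k\setminus\mathscr S$ the algebra $A_a$ has the PBW property: if $F_\ell$ is the $k$-span in $A_a$ of all monomials of degree $\le\ell$ in $x_1,\dots,x_n$ and $F_{-1}=0$, then there is an isomorphism of graded vector spaces $$\bigoplus_{\ell\ge0}F_\ell/F_{\ell-1}\simeq S(V),$$ that is, $F_\ell/F_{\ell-1}\simeq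 S^\ell(V)$ for every $\ell\ge 0$. -/

import Mathlib

open Polynomial DirectSum TensorProduct

noncomputable section

namespace QuadraticPBW

/-! ## The descending filtration by powers of `ħ`

`k[X]` is the polynomial ring `k[ħ]`, with `ħ = X`. -/

section Descending

variable (k : Type*) [Field k] (A : Type*) [Ring A] [Algebra k[X] A]

/-- `Γ_ℓ = ħ^ℓ A`. -/
def Gam (l : ℕ) : Submodule k[X] A :=
  LinearMap.range (LinearMap.lsmul k[X] A (X ^ l))

variable {k A} in
theorem mem_Gam {l : ℕ} {a : A} : a ∈ Gam k A l ↔ ∃ b : A, (X ^ l : k[X]) • b = a :=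
  Iff.rfl

variable {k A} in
theorem mul_mem_Gam {i j : ℕ} {a b : A} (ha : a ∈ Gam k A i) (hb : b ∈ Gam k A j) :
    a * b ∈ Gam k A (i + j) := by
  obtain ⟨a, rfl⟩ := mem_Gam.1 ha
  obtain ⟨b, rfl⟩ := mem_Gam.1 hb
  exact mem_Gam.2 ⟨a * b, by rw [smul_mul_smul_comm, pow_add]⟩

variable {k A} in
theorem mem_Gam_zero (a : A) : a ∈ Gam k A 0 :=
  mem_Gam.2 ⟨a, by simp⟩

/-- `Γ_ℓ / Γ_{ℓ+1}`. -/
def GrGam (l : ℕ) : Type _ :=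
  Gam k A l ⧸ (Gam k A (l + 1)).submoduleOf (Gam k A l)

instance (l : ℕ) : AddCommGroup (GrGam k A l) :=
  inferInstanceAs (AddCommGroup (Gam k A l ⧸ (Gam k A (l + 1)).submoduleOf (Gam k A l)))

variable {k A} in
/-- The class in `Γ_ℓ / Γ_{ℓ+1}` of an element of `Γ_ℓ`. -/
def symb (l : ℕ) (a : Gam k A l) : GrGam k A l :=
  Submodule.Quotient.mk (p := (Gam k A (l + 1)).submoduleOf (Gam k A l)) a

variable {k A} in
theorem symb_surjective (l : ℕ) (x : GrGam k A l) : ∃ a, symb l a = x :=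
  Submodule.Quotient.mk_surjective _ x

variable {k A} in
theorem symb_eq {l : ℕ} {a b : Gam k A l} :
    symb l a = symb l b ↔ (a : A) - b ∈ Gam k A (l + 1) :=
  Submodule.Quotient.eq ((Gam k A (l + 1)).submoduleOf (Gam k A l))

variable {k A} in
/-- The product `Γ_i/Γ_{i+1} × Γ_j/Γ_{j+1} → Γ_{i+j}/Γ_{i+j+1}` induced by that of `A`. -/
def grMul {i j : ℕ} (x : GrGam k A i) (y : GrGam k A j) : GrGam k A (i + j) :=
  Quotient.liftOn₂' x y (fun a b => symb (i + j) ⟨(a : A) * (b : A), mul_mem_Gam a.2 b.2⟩) (by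
    intro a b a' b' ha hb
    have ha' : (a : A) - a' ∈ Gam k A (i + 1) := symb_eq.1 (Quotient.sound' ha)
    have hb' : (b : A) - b' ∈ Gam k A (j + 1) := symb_eq.1 (Quotient.sound' hb)
    refine symb_eq.2 ?_
    have h1 := mul_mem_Gam ha' b.2
    have h2 := mul_mem_Gam a'.2 hb'
    rw [show i + 1 + j = i + j + 1 by omega] at h1
    rw [show i + (j + 1) = i + j + 1 by omega] at h2
    have h3 := add_mem h1 h2
    have h4 : ((a : A) - a') * b + a' * (b - b') = a * b - a' * b' := by noncomm_ring
    rwa [h4] at h3)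

variable {k A} in
theorem grMul_symb {i j : ℕ} (a : Gam k A i) (b : Gam k A j) :
    grMul (symb i a) (symb j b) = symb (i + j) ⟨(a : A) * (b : A), mul_mem_Gam a.2 b.2⟩ :=
  rfl

variable {k A} in
theorem symb_add {i : ℕ} (a b : Gam k A i) : symb i (a + b) = symb i a + symb i b :=
  rfl

variable {k A} in
theorem mk_symb_congr {i j : ℕ} (h : i = j) (a : Gam k A i) (b : Gam k A j) (hab : (a : A) = b) :
    (GradedMonoid.mk i (symb i a) : GradedMonoid (GrGam k A)) = GradedMonoid.mk j (symb j b) := by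
  subst h
  rw [Subtype.ext hab]

instance grGOne : GradedMonoid.GOne (GrGam k A) where
  one := symb 0 ⟨1, mem_Gam_zero 1⟩

instance grGMul : GradedMonoid.GMul (GrGam k A) where
  mul := grMul

/-- The ring structure of the associated graded ring `⨁_ℓ Γ_ℓ/Γ_{ℓ+1}`. -/
instance grRing : DirectSum.GRing (GrGam k A) where
  mul_zero := by
    intro i j x
    obtain ⟨a, rfl⟩ := symb_surjective i x
    change grMul (symb i a) (symb j 0) = symb (i + j) 0
    rw [grMul_symb]
    congr 1
    ext
    simp
  zero_mul := by
    intro i j x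
    obtain ⟨a, rfl⟩ := symb_surjective j x
    change grMul (symb i 0) (symb j a) = symb (i + j) 0
    rw [grMul_symb]
    congr 1
    ext
    simp
  mul_add := by
    intro i j x y z
    obtain ⟨a, rfl⟩ := symb_surjective i x
    obtain ⟨b, rfl⟩ := symb_surjective j y
    obtain ⟨c, rfl⟩ := symb_surjective j z
    change grMul (symb i a) (symb j b + symb j c) =
      grMul (symb i a) (symb j b) + grMul (symb i a) (symb j c)
    rw [← symb_add, grMul_symb, grMul_symb, grMul_symb, ← symb_add]
    congr 1
    ext
    simp [mul_add]
  add_mul := by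
    intro i j x y z
    obtain ⟨a, rfl⟩ := symb_surjective i x
    obtain ⟨b, rfl⟩ := symb_surjective i y
    obtain ⟨c, rfl⟩ := symb_surjective j z
    change grMul (symb i a + symb i b) (symb j c) =
      grMul (symb i a) (symb j c) + grMul (symb i b) (symb j c)
    rw [← symb_add, grMul_symb, grMul_symb, grMul_symb, ← symb_add]
    congr 1
    ext
    simp [add_mul]
  one_mul := by
    rintro ⟨i, x⟩
    obtain ⟨a, rfl⟩ := symb_surjective i x
    exact mk_symb_congr (zero_add i) _ _ (one_mul _)
  mul_one := by
    rintro ⟨i, x⟩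
    obtain ⟨a, rfl⟩ := symb_surjective i x
    exact mk_symb_congr (add_zero i) _ _ (mul_one _)
  mul_assoc := by
    rintro ⟨i, x⟩ ⟨j, y⟩ ⟨l, z⟩
    obtain ⟨a, rfl⟩ := symb_surjective i x
    obtain ⟨b, rfl⟩ := symb_surjective j y
    obtain ⟨c, rfl⟩ := symb_surjective l z
    exact mk_symb_congr (add_assoc i j l) _ _ (mul_assoc _ _ _)
  natCast n := symb 0 ⟨n, mem_Gam_zero _⟩
  natCast_zero := by
    change symb 0 _ = symb 0 0
    congr 1
    ext
    simp
  natCast_succ n := by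
    change symb 0 _ = symb 0 _ + symb 0 _
    rw [← symb_add]
    congr 1
    ext
    simp
  intCast n := symb 0 ⟨n, mem_Gam_zero _⟩
  intCast_ofNat n := by
    change symb 0 _ = symb 0 _
    congr 1
    ext
    simp
  intCast_negSucc_ofNat n := by
    change symb 0 _ = symb 0 (-_)
    congr 1
    ext
    simp [Int.cast_negSucc]

/-- `gr_Γ A = ⨁_{ℓ ≥ 0} Γ_ℓ/Γ_{ℓ+1}`. -/
abbrev Gr : Type _ := ⨁ l, GrGam k A l

/-- Degree zero part of `A → gr_Γ A`, restricted to the scalars: `c ↦ [c · 1] ∈ Γ_0/Γ_1`. -/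
def grScalar : k →+* Gr k A where
  toFun c := DirectSum.of (GrGam k A) 0
    (symb 0 ⟨algebraMap k[X] A (C c), mem_Gam_zero _⟩)
  map_one' := by
    rw [DirectSum.one_def]
    congr 2
    ext
    simp
  map_zero' := by
    rw [← map_zero (DirectSum.of (GrGam k A) 0)]
    congr 1
    change symb 0 _ = symb 0 0
    congr 1
    ext
    simp
  map_add' c d := by
    rw [← map_add, ← symb_add]
    congr 2
    ext
    simp
  map_mul' c d := by
    rw [DirectSum.of_mul_of]
    refine DirectSum.of_eq_of_gradedMonoid_eq (mk_symb_congr (zero_add 0).symm _ _ ?_)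
    simp

/-- The class `[ħ · 1] ∈ Γ_1/Γ_2`, as an element of `gr_Γ A`. -/
def grHbar : Gr k A :=
  DirectSum.of (GrGam k A) 1 (symb 1 ⟨algebraMap k[X] A X, mem_Gam.2 ⟨1, by
    rw [pow_one, Algebra.algebraMap_eq_smul_one]⟩⟩)

theorem grScalar_commute_grHbar (c : k) : Commute (grScalar k A c) (grHbar k A) := by
  change DirectSum.of (GrGam k A) 0 _ * DirectSum.of (GrGam k A) 1 _ =
    DirectSum.of (GrGam k A) 1 _ * DirectSum.of (GrGam k A) 0 _
  rw [DirectSum.of_mul_of, DirectSum.of_mul_of]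
  refine DirectSum.of_eq_of_gradedMonoid_eq (mk_symb_congr (by omega) _ _ ?_)
  exact Algebra.commutes _ _

/-- The structure map `k[ħ] → gr_Γ A` of the graded `k[ħ]`-algebra `gr_Γ A`; here `k[ħ]` is graded
by powers of `ħ`, and `ħ` acts as multiplication by its class in `Γ_1/Γ_2`. -/
def grStructureMap : k[X] →+* Gr k A :=
  Polynomial.eval₂RingHom' (grScalar k A) (grHbar k A) (grScalar_commute_grHbar k A)

/-- The PBW-like property for the descending filtration `Γ`: there is an isomorphism
`S(V)[ħ] ≃ gr_Γ A` of rings, compatible with the structure maps from `k[ħ]`, which carries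
`ħ^ℓ S(V)` onto `Γ_ℓ/Γ_{ℓ+1}` for all `ℓ`. Here `S(V) = k[x_1, …, x_n]`. -/
def DescendingPBW (n : ℕ) : Prop :=
  ∃ e : (MvPolynomial (Fin n) k)[X] ≃+* Gr k A,
    (e : (MvPolynomial (Fin n) k)[X] →+* Gr k A).comp (Polynomial.mapRingHom MvPolynomial.C) =
        grStructureMap k A ∧
      ∀ l : ℕ, e '' Set.range (fun p : MvPolynomial (Fin n) k => Polynomial.monomial l p) =
        Set.range (DirectSum.of (GrGam k A) l)

/-- `⋂_ℓ Γ_ℓ`. -/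
def GamInf : Submodule k[X] A := ⨅ l : ℕ, Gam k A l

/-- The point `ħ = a` of the affine line `Spec k[ħ]`. -/
def point (a : k) : PrimeSpectrum k[X] :=
  ⟨Ideal.span {X - C a},
    (Ideal.span_singleton_prime (X_sub_C_ne_zero a)).2 (prime_X_sub_C a)⟩

/-- The set of `a ∈ k` which lie in the support of the `k[ħ]`-module `⋂_ℓ Γ_ℓ`. -/
def exceptionalSet : Set k := {a | point k a ∈ Module.support k[X] (GamInf k A)}

end Descending

/-! ## The ascending filtration and the PBW property over `k` -/

section Ascending

variable (k : Type*) [Field k] {n : ℕ} {B : Type*} [Ring B] [Algebra k B] (x : Fin n → B)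

/-- `F_m`: the span of the monomials of degree `≤ m` in the `x_i`. In particular `F_{-1} = 0`. -/
def Fil (m : ℤ) : Submodule k B :=
  Submodule.span k {b | ∃ w : List (Fin n), (w.length : ℤ) ≤ m ∧ b = (w.map x).prod}

/-- The PBW property of a `k`-algebra `B` generated by `x_1, …, x_n`: the graded vector spaces
`⨁_ℓ F_ℓ/F_{ℓ-1}` and `S(V) = k[x_1, …, x_n]` are isomorphic. -/
def IsPBW : Prop :=
  ∀ l : ℕ, Nonempty ((Fil k x l ⧸ (Fil k x ((l : ℤ) - 1)).submoduleOf (Fil k x l)) ≃ₗ[k]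
    MvPolynomial.homogeneousSubmodule (Fin n) k l)

end Ascending

/-! ## The algebra `A` and its specializations -/

section Algebras

variable {k : Type*} [Field k] {n : ℕ}

/-- The defining relations `x_i ⊗ x_j - x_j ⊗ x_i - φ_ij = 0`, `i < j`, in `T(V)[ħ]`, the free
algebra over `k[ħ]` on `x_1, …, x_n`. -/
inductive Rel (φ : Fin n → Fin n → FreeAlgebra k[X] (Fin n)) :
    FreeAlgebra k[X] (Fin n) → FreeAlgebra k[X] (Fin n) → Prop
  | comm (i j : Fin n) (h : i < j) :
      Rel φ (FreeAlgebra.ι k[X] i * FreeAlgebra.ι k[X] j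
        - FreeAlgebra.ι k[X] j * FreeAlgebra.ι k[X] i - φ i j) 0

/-- `A = T(V)[ħ] / (x_i ⊗ x_j - x_j ⊗ x_i - φ_ij)_{i < j}`. -/
abbrev Alg (φ : Fin n → Fin n → FreeAlgebra k[X] (Fin n)) : Type _ := RingQuot (Rel φ)

/-- The image of `x_i` in `A`. -/
def gen (φ : Fin n → Fin n → FreeAlgebra k[X] (Fin n)) (i : Fin n) : Alg φ :=
  RingQuot.mkAlgHom k[X] (Rel φ) (FreeAlgebra.ι k[X] i)

/-- The specialization `A_a = k[ħ]/(ħ - a) ⊗_{k[ħ]} A`. -/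
abbrev Spec (φ : Fin n → Fin n → FreeAlgebra k[X] (Fin n)) (a : k) : Type _ :=
  (k[X] ⧸ Ideal.span {X - C a}) ⊗[k[X]] Alg φ

/-- The image of `x_i` in `A_a`. -/
def specGen (φ : Fin n → Fin n → FreeAlgebra k[X] (Fin n)) (a : k) (i : Fin n) : Spec φ a :=
  1 ⊗ₜ[k[X]] gen φ i

/-- `φ_ij = ħ ∑_{a,b} α_ij^{ab} x_a ⊗ x_b`; the coefficient `α_ij^{ab}` is written `α i j a b`. -/
def quadPhi (α : Fin n → Fin n → Fin n → Fin n → k) (i j : Fin n) : FreeAlgebra k[X] (Fin n) :=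
  (X : k[X]) • ∑ a, ∑ b, C (α i j a b) • (FreeAlgebra.ι k[X] a * FreeAlgebra.ι k[X] b)

/-- The sum of `f` over the cyclic permutations of `(i, j, l)`. -/
def cycl (f : Fin n → Fin n → Fin n → k) (i j l : Fin n) : k :=
  f i j l + f j l i + f l i j

end Algebras

end QuadraticPBW

end

/-! The crux is that A = T/I has no ħ-torsion, where T is the free algebra over k[ħ] and I the ideal
of the defects r_ij = x_i x_j - x_j x_i - φ_ij. Work in E = T/ħI. There ħ kills every r_ij, and the
x_i commute up to r_ij modulo ħ. The commutators satisfy the Jacobi identity, and the cyclic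
condition on α makes the φ-terms cancel, so the r_ij satisfy it too. Hence the cost in E of sorting
a word is well behaved: exchanging adjacent letters of u i j v changes it by u r_ij v. The cost
extends linearly to G : T → E with ħG = 0, and G agrees with the projection f on I. If ħt ∈ I, then
f(ħt) = G(ħt) = ħG(t) = 0, so ħt ∈ ħI and t ∈ I (`eq_zero_of_smul_eq_zero`).

Since A/ħA is the polynomial ring, torsion-freeness identifies each Γ_ℓ/Γ_{ℓ+1} with S(V).

For the specializations, use that the relations are homogeneous in the x_i, so A is a sum of
finitely generated k[ħ]-modules A_d. By Nakayama the part of ⋂Γ_ℓ in A_d is killed by one nonzero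
polynomial, so exceptional points are roots of countably many polynomials. Away from them A has no
(ħ - c)-torsion, so the fibre of A_d at c has the generic rank of A_d, which is also the dimension
of its fibre S^d(V) at 0. That fibre is F_d/F_{d-1} (`finrank_fiber`, `isPBW`). -/

noncomputable section

namespace QuadraticPBW

/-! ## Sorting words in an algebra whose generators commute up to a cocycle

Let `x i` be elements of a ring whose commutators are `r i j` modulo `h`, where `h` kills `r i j` and
`r` satisfies the Jacobi identity. Then `r` is a coboundary on words in the `x i`: the cost of
sorting a word changes by `u * r i j * v` when two adjacent letters of `u i j v` are exchanged. -/

section Sorting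

variable {ι R E : Type*} [CommRing R] [Ring E] [Algebra R E]

/-- The `x i` commute up to `r`, modulo `h`, and `r` is an alternating cocycle killed by `h`. -/
structure IsCommutatorCocycle (h : R) (x : ι → E) (r : ι → ι → E) : Prop where
  smul_eq_zero : ∀ i j, h • r i j = 0
  antisymm : ∀ i j, r i j = -r j i
  self : ∀ i, r i i = 0
  commutator : ∀ i j, ∃ e, x i * x j - x j * x i = r i j + h • e
  jacobi : ∀ i j l, (x i * r j l - r j l * x i) + (x j * r l i - r l i * x j) +
    (x l * r i j - r i j * x l) = 0

namespace IsCommutatorCocycle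

variable {h : R} {x : ι → E} {r : ι → ι → E} (H : IsCommutatorCocycle h x r)
include H

/-- The error h • e in the commutator dies against m. Costs are killed by h, so letters may be
exchanged exactly in front of them. -/
theorem commutator_mul (i j : ι) {m : E} (hm : h • m = 0) :
    x i * (x j * m) = x j * (x i * m) + r i j * m := by
  obtain ⟨e, he⟩ := H.commutator i j
  rw [← mul_assoc, sub_eq_iff_eq_add.1 he, add_mul, add_mul, smul_mul_assoc, ← mul_smul_comm, hm]
  simp only [mul_zero, mul_assoc]
  abel

theorem mul_smul_eq_zero (i j : ι) (e : E) : r i j * h • e = 0 := by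
  rw [mul_smul_comm, ← smul_mul_assoc, H.smul_eq_zero, zero_mul]

end IsCommutatorCocycle

variable [LinearOrder ι]

/-- The cost of inserting the letter `i` into a word. -/
def insertCost (x : ι → E) (r : ι → ι → E) (i : ι) : List ι → E
  | [] => 0
  | y :: s => if i ≤ y then 0 else r i y * (s.map x).prod + x y * insertCost x r i s

/-- The cost of sorting a word by insertion. -/
def sortCost (x : ι → E) (r : ι → ι → E) : List ι → E
  | [] => 0
  | i :: w => x i * sortCost x r w + insertCost x r i (w.insertionSort (· ≤ ·))

namespace IsCommutatorCocycle

variable {h : R} {x : ι → E} {r : ι → ι → E} (H : IsCommutatorCocycle h x r)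
include H

theorem smul_insertCost (i : ι) (s : List ι) : h • insertCost x r i s = 0 := by
  induction s with
  | nil => simp [insertCost]
  | cons y s ih =>
    rw [insertCost]
    split_ifs
    · simp
    · rw [smul_add, ← smul_mul_assoc, H.smul_eq_zero, ← mul_smul_comm, ih]
      simp

theorem smul_sortCost (w : List ι) : h • sortCost x r w = 0 := by
  induction w with
  | nil => simp [sortCost]
  | cons i w ih => rw [sortCost, smul_add, ← mul_smul_comm, ih, H.smul_insertCost]; simp

theorem mul_prod_eq (i : ι) (s : List ι) : ∃ e, x i * (s.map x).prod =
    ((s.orderedInsert (· ≤ ·) i).map x).prod + insertCost x r i s + h • e := by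
  induction s with
  | nil => exact ⟨0, by simp [insertCost]⟩
  | cons y s ih =>
    obtain ⟨e, he⟩ := ih
    rw [List.orderedInsert_cons, insertCost]
    split_ifs
    · exact ⟨0, by simp⟩
    · obtain ⟨e', he'⟩ := H.commutator i y
      refine ⟨x y * e + e' * (s.map x).prod, ?_⟩
      simp only [List.map_cons, List.prod_cons]
      rw [← mul_assoc, sub_eq_iff_eq_add.1 he', add_mul, add_mul, mul_assoc (x y), he]
      simp only [mul_add, smul_add, mul_smul_comm, smul_mul_assoc]
      abel

theorem prod_eq (w : List ι) : ∃ e, (w.map x).prod =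
    ((w.insertionSort (· ≤ ·)).map x).prod + sortCost x r w + h • e := by
  induction w with
  | nil => exact ⟨0, by simp [sortCost]⟩
  | cons i w ih =>
    obtain ⟨e, he⟩ := ih
    obtain ⟨e', he'⟩ := H.mul_prod_eq i (w.insertionSort (· ≤ ·))
    refine ⟨x i * e + e', ?_⟩
    rw [List.insertionSort_cons, List.map_cons, List.prod_cons, he, mul_add, mul_add, he', sortCost]
    simp only [smul_add, mul_smul_comm]
    abel

/-- If the head y is at least i, only the exchange of i and j separates the two sides. If y < i,
both letters pass y, and the two orders of the three exchanges among i, j, y differ by the Jacobi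
identity times the remaining word. -/
theorem insertCost_comm (i j : ι) (hij : i < j) (s : List ι) :
    x i * insertCost x r j s + insertCost x r i (s.orderedInsert (· ≤ ·) j) =
      x j * insertCost x r i s + insertCost x r j (s.orderedInsert (· ≤ ·) i) +
        r i j * (s.map x).prod := by
  induction s with
  | nil => simp [insertCost, hij.le, hij.not_ge, H.antisymm i j]
  | cons y s ih =>
    by_cases hj : j ≤ y
    · simp [insertCost, hij.le.trans hj, hj, hij.le, hij.not_ge, H.antisymm i j]
    · by_cases hi : i ≤ y
      · simp [insertCost, hj, hi, hij.not_ge, H.antisymm i j]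
      · obtain ⟨e, he⟩ := H.mul_prod_eq j s
        obtain ⟨e', he'⟩ := H.mul_prod_eq i s
        have h1 := H.commutator_mul i y (H.smul_insertCost j s)
        have h2 := H.commutator_mul j y (H.smul_insertCost i s)
        -- A cost is an unsorted product minus the sorted one modulo h, and r kills multiples of h.
        have h3 : r i y * insertCost x r j s = r i y * (x j * (s.map x).prod) -
            r i y * ((s.orderedInsert (· ≤ ·) j).map x).prod := by
          rw [he, mul_add, mul_add, H.mul_smul_eq_zero]
          abel
        have h4 : r j y * insertCost x r i s = r j y * (x i * (s.map x).prod) -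
            r j y * ((s.orderedInsert (· ≤ ·) i).map x).prod := by
          rw [he', mul_add, mul_add, H.mul_smul_eq_zero]
          abel
        have h5 := congrArg (· * (s.map x).prod) (H.jacobi i j y)
        have h6 := congrArg (x y * ·) ih
        simp only [H.antisymm y i, mul_add, add_mul, sub_mul, mul_assoc, neg_mul, mul_neg,
          zero_mul] at h5 h6
        simp only [List.orderedInsert_cons, insertCost, hi, hj, if_false, List.map_cons,
          List.prod_cons, mul_add]
        rw [h1, h2, h3, h4]
        rw [← sub_eq_zero] at h6 ⊢
        refine Eq.trans ?_ ((congrArg₂ (· + ·) h6 h5).trans (add_zero 0))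
        abel

theorem sortCost_cons_cons (i j : ι) (v : List ι) :
    sortCost x r (i :: j :: v) = sortCost x r (j :: i :: v) + r i j * (v.map x).prod := by
  wlog hij : i < j generalizing i j
  · obtain rfl | hji := (not_lt.1 hij).eq_or_lt
    · simp [H.self]
    · rw [this j i hji, H.antisymm i j]
      simp
  · obtain ⟨e, he⟩ := H.prod_eq v
    have h1 := H.commutator_mul i j (H.smul_sortCost v)
    have h2 := H.insertCost_comm i j hij (v.insertionSort (· ≤ ·))
    have h3 := congrArg (r i j * ·) he
    simp only [mul_add, H.mul_smul_eq_zero] at h3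
    simp only [sortCost, mul_add, List.insertionSort_cons]
    rw [h1, add_assoc, h2, h3]
    abel

/-- The two tails are permutations of each other, hence have the same sorted form; inserting a
further letter on the left therefore costs the same for both. -/
theorem sortCost_append (u v : List ι) (i j : ι) :
    sortCost x r (u ++ i :: j :: v) =
      sortCost x r (u ++ j :: i :: v) + (u.map x).prod * r i j * (v.map x).prod := by
  induction u with
  | nil => simpa using H.sortCost_cons_cons i j v
  | cons a u ih =>
    have h1 : (u ++ i :: j :: v).insertionSort (· ≤ ·) =
        (u ++ j :: i :: v).insertionSort (· ≤ ·) :=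
      (((List.perm_insertionSort _ _).trans
        ((List.Perm.swap j i v).append_left u)).trans (List.perm_insertionSort _ _).symm).eq_of_pairwise'
          (List.pairwise_insertionSort _ _) (List.pairwise_insertionSort _ _)
    simp only [List.cons_append, sortCost, ih, h1, mul_add, List.map_cons, List.prod_cons,
      mul_assoc]
    abel

end IsCommutatorCocycle

end Sorting

end QuadraticPBW
end

noncomputable section

namespace QuadraticPBW

universe u

/-! ### The cyclic condition as a Jacobi identity for the defects -/

section Jacobi

variable {ι R E : Type*} [Fintype ι] [CommRing R] [Ring E] [Algebra R E]

/-- The quadratic expression `∑ c_ij^{ab} x_a x_b`. -/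
def quadForm (c : ι → ι → ι → ι → R) (x : ι → E) (i j : ι) : E :=
  ∑ a, ∑ b, c i j a b • (x a * x b)

/-- Leibniz rule for the commutator with x_i, after which the factor h turns each inner commutator
into h² times a quadratic form. The resulting cubic coefficients are those of the cyclic condition.
-/
theorem smul_commutator_quadForm (c : ι → ι → ι → ι → R) (x : ι → E) (h : R)
    (hx : ∀ i j, h • (x i * x j - x j * x i) = h • h • quadForm c x i j) (i j l : ι) :
    h • (x i * quadForm c x j l - quadForm c x j l * x i) = h • h • ∑ a, ∑ d, ∑ b,
      (∑ s, (c j l s b * c i s a d + c j l a s * c i s d b)) • (x a * x d * x b) := by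
  have h1 : h • (x i * quadForm c x j l - quadForm c x j l * x i) = ∑ a, ∑ b, c j l a b •
      ((h • (x i * x a - x a * x i)) * x b + x a * (h • (x i * x b - x b * x i))) := by
    simp only [quadForm, Finset.mul_sum, Finset.sum_mul, ← Finset.sum_sub_distrib,
      Finset.smul_sum]
    refine Finset.sum_congr rfl fun a _ => Finset.sum_congr rfl fun b _ => ?_
    rw [smul_mul_assoc (c j l a b), mul_smul_comm (c j l a b), ← smul_sub, smul_comm h, smul_mul_assoc h, mul_smul_comm h,
      ← smul_add]
    congr 2
    noncomm_ring
  have h2 : ∑ a, ∑ b, c j l a b • (quadForm c x i a * x b) =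
      ∑ a, ∑ d, ∑ b, (∑ s, c j l s b * c i s a d) • (x a * x d * x b) := by
    simp only [quadForm, Finset.sum_mul, Finset.smul_sum, smul_mul_assoc, Finset.sum_smul,
      smul_smul]
    calc _ = ∑ s, ∑ a, ∑ b, ∑ d, (c j l s b * c i s a d) • (x a * x d * x b) :=
          Finset.sum_congr rfl fun s _ => Finset.sum_comm
      _ = ∑ a, ∑ s, ∑ d, ∑ b, (c j l s b * c i s a d) • (x a * x d * x b) := by
          rw [Finset.sum_comm]
          exact Finset.sum_congr rfl fun s _ => Finset.sum_congr rfl fun a _ => Finset.sum_comm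
      _ = ∑ a, ∑ d, ∑ s, ∑ b, (c j l s b * c i s a d) • (x a * x d * x b) :=
          Finset.sum_congr rfl fun a _ => Finset.sum_comm
      _ = _ := Finset.sum_congr rfl fun a _ => Finset.sum_congr rfl fun d _ => Finset.sum_comm
  have h3 : ∑ a, ∑ s, c j l a s • (x a * quadForm c x i s) =
      ∑ a, ∑ d, ∑ b, (∑ s, c j l a s * c i s d b) • (x a * x d * x b) := by
    simp only [quadForm, Finset.mul_sum, Finset.smul_sum, mul_smul_comm, Finset.sum_smul,
      smul_smul, ← mul_assoc]
    refine Finset.sum_congr rfl fun a _ => ?_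
    rw [Finset.sum_comm]
    exact Finset.sum_congr rfl fun d _ => Finset.sum_comm
  rw [h1]
  simp only [hx, Finset.sum_add_distrib, add_smul, smul_add]
  rw [← h2, ← h3]
  simp only [Finset.smul_sum, smul_mul_assoc, mul_smul_comm, smul_comm h]

/-- The defect `x_i x_j - x_j x_i - h ∑ c_ij^{ab} x_a x_b` of a quadratic commutation relation. -/
def commDefect (h : R) (c : ι → ι → ι → ι → R) (x : ι → E) (i j : ι) : E :=
  x i * x j - x j * x i - h • quadForm c x i j

/-- The cyclic identity for the coefficients of an alternating family of quadratic forms. -/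
structure IsCyclic (c : ι → ι → ι → ι → R) : Prop where
  antisymm : ∀ i j a b, c i j a b = -c j i a b
  self : ∀ i a b, c i i a b = 0
  cyclic : ∀ i j l a d b, ∑ s, (c j l s b * c i s a d + c j l a s * c i s d b) +
    ∑ s, (c l i s b * c j s a d + c l i a s * c j s d b) +
    ∑ s, (c i j s b * c l s a d + c i j a s * c l s d b) = 0

theorem commDefect_antisymm {c : ι → ι → ι → ι → R} (hc : ∀ i j a b, c i j a b = -c j i a b)
    (h : R) (x : ι → E) (i j : ι) : commDefect h c x i j = -commDefect h c x j i := by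
  have : quadForm c x i j = -quadForm c x j i := by
    simp only [quadForm, ← Finset.sum_neg_distrib, ← neg_smul]
    simp_rw [← hc]
  rw [commDefect, commDefect, this, smul_neg]
  abel

theorem commDefect_self {c : ι → ι → ι → ι → R} (hc : ∀ i a b, c i i a b = 0)
    (h : R) (x : ι → E) (i : ι) : commDefect h c x i i = 0 := by
  simp [commDefect, quadForm, hc]

theorem map_commDefect {T : Type*} [Ring T] [Algebra R T] (f : T →ₐ[R] E)
    (h : R) (c : ι → ι → ι → ι → R) (x : ι → T) (i j : ι) :
    f (commDefect h c x i j) = commDefect h c (fun i => f (x i)) i j := by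
  simp [commDefect, quadForm]

/-- The defects of quadratic relations satisfying the cyclic identity form a cocycle as soon as they
are killed by `h`. -/
theorem IsCyclic.isCommutatorCocycle {c : ι → ι → ι → ι → R} (hc : IsCyclic c) {h : R} {x : ι → E}
    (hx : ∀ i j, h • commDefect h c x i j = 0) :
    IsCommutatorCocycle h x (commDefect h c x) where
  smul_eq_zero := hx
  antisymm := commDefect_antisymm hc.antisymm h x
  self := commDefect_self hc.self h x
  commutator i j := ⟨quadForm c x i j, by rw [commDefect]; abel⟩
  jacobi i j l := by
    have hx' (i j) : h • (x i * x j - x j * x i) = h • h • quadForm c x i j := by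
      rw [← sub_eq_zero, ← smul_sub]
      exact hx i j
    have h1 : h • (x i * quadForm c x j l - quadForm c x j l * x i) +
        h • (x j * quadForm c x l i - quadForm c x l i * x j) +
        h • (x l * quadForm c x i j - quadForm c x i j * x l) = 0 := by
      simp only [smul_commutator_quadForm c x h hx', ← smul_add, ← Finset.sum_add_distrib,
        ← add_smul]
      have h2 := hc.cyclic i j l
      simp only [← Finset.sum_add_distrib] at h2
      simp [h2]
    -- The commutators satisfy the Jacobi identity, so only the terms in h • `quadForm` survive,
    -- with a minus sign.
    rw [← neg_eq_zero, ← h1]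
    simp only [commDefect, mul_sub, sub_mul, smul_sub, mul_smul_comm, smul_mul_assoc, mul_assoc]
    abel

end Jacobi

/-! ### Kernels of quotient maps and the word basis -/

section Kernel

theorem mem_of_mkAlgHom_eq_zero {S T : Type*} [CommRing S] [Ring T] [Algebra S T]
    {s : T → T → Prop} (J : TwoSidedIdeal T) (hJ : ∀ a b, s a b → a - b ∈ J) {t : T}
    (ht : RingQuot.mkAlgHom S s t = 0) : t ∈ J := by
  have h1 : ∀ ⦃a b⦄, s a b → J.ringCon.mk' a = J.ringCon.mk' b := fun a b hab =>
    (RingCon.eq _).2 ((TwoSidedIdeal.rel_iff _ _ _).2 (hJ a b hab))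
  have h2 := RingQuot.lift_mkRingHom_apply J.ringCon.mk' h1 t
  rw [← RingQuot.mkAlgHom_coe S, RingHom.coe_coe, ht, map_zero] at h2
  have h3 := (RingCon.eq _).1 (h2.symm.trans (map_zero J.ringCon.mk').symm)
  rwa [TwoSidedIdeal.rel_iff, sub_zero] at h3

theorem exists_algHom_eq_zero_iff {S : Type*} {T : Type u} [CommRing S] [Ring T] [Algebra S T]
    (J : TwoSidedIdeal T) : ∃ (E : Type u) (_ : Ring E) (_ : Algebra S E) (f : T →ₐ[S] E),
      ∀ t, f t = 0 ↔ t ∈ J :=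
  ⟨J.ringCon.Quotient, inferInstance, inferInstance, J.ringCon.mkₐ S, fun t => by
    rw [← map_zero (J.ringCon.mkₐ S), TwoSidedIdeal.mem_iff]
    exact RingCon.eq _⟩

theorem basisFreeMonoid_ofList (R : Type*) {ι : Type*} [CommRing R] (w : List ι) :
    FreeAlgebra.basisFreeMonoid R ι (FreeMonoid.ofList w) = (w.map (FreeAlgebra.ι R)).prod := by
  simp [FreeAlgebra.basisFreeMonoid, FreeAlgebra.equivMonoidAlgebraFreeMonoid, FreeMonoid.lift_apply]

end Kernel

end QuadraticPBW
end

noncomputable section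

namespace QuadraticPBW

/-! ### Absence of h-torsion -/

section TorsionFree

variable {n : ℕ} {R T : Type*} [CommRing R] [Ring T] [Algebra R T] {y : Fin n → T}

theorem map_word {S S' : Type*} [Ring S] [Ring S'] (f : S →+* S') (x : Fin n → S)
    (w : List (Fin n)) : f (w.map x).prod = (w.map fun i => f (x i)).prod := by
  rw [map_list_prod, List.map_map]
  rfl

@[elab_as_elim]
theorem induction_words (hy : Submodule.span R (Set.range fun w : List (Fin n) => (w.map y).prod) = ⊤)
    {p : T → Prop} (t : T) (zero : p 0) (add : ∀ a b, p a → p b → p (a + b))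
    (smul : ∀ (c : R) a, p a → p (c • a)) (word : ∀ w : List (Fin n), p (w.map y).prod) : p t := by
  have ht : t ∈ Submodule.span R (Set.range fun w : List (Fin n) => (w.map y).prod) :=
    hy ▸ Submodule.mem_top
  induction ht using Submodule.span_induction with
  | mem x hx =>
    obtain ⟨w, rfl⟩ := hx
    exact word w
  | zero => exact zero
  | add a b _ _ ha hb => exact add a b ha hb
  | smul c a _ ha => exact smul c a ha

/-- Let `f` be an algebra map on the free algebra such that `h` kills the images of the defects. On
the ideal generated by the defects, `f` agrees with a linear map which is killed by `h`. -/
theorem exists_linearMap_eq_on_defects {E : Type*} [Ring E] [Algebra R E]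
    (b : Module.Basis (List (Fin n)) R T) (hb : ∀ w, b w = (w.map y).prod)
    {c : Fin n → Fin n → Fin n → Fin n → R} (hc : IsCyclic c) {h : R} (f : T →ₐ[R] E)
    (hf : ∀ i j, h • f (commDefect h c y i j) = 0) :
    ∃ G : T →ₗ[R] E, (∀ t, h • G t = 0) ∧
      ∀ t, (∀ J : TwoSidedIdeal T, (∀ i j, commDefect h c y i j ∈ J) → t ∈ J) → G t = f t := by
  have H : IsCommutatorCocycle h (fun i => f (y i)) (commDefect h c fun i => f (y i)) :=
    hc.isCommutatorCocycle fun i j => by rw [← map_commDefect, hf]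
  have hy : Submodule.span R (Set.range fun w : List (Fin n) => (w.map y).prod) = ⊤ := by
    rw [← b.span_eq]
    simp_rw [← hb]
  let G : T →ₗ[R] E := b.constr R (sortCost (fun i => f (y i)) (commDefect h c fun i => f (y i)))
  have hG (w : List (Fin n)) :
      G (w.map y).prod = sortCost (fun i => f (y i)) (commDefect h c fun i => f (y i)) w := by
    rw [← hb, Module.Basis.constr_basis]
  have hXG (t) : h • G t = 0 := by
    induction t using induction_words hy with
    | zero => simp
    | add a b ha hb => rw [map_add, smul_add, ha, hb, add_zero]
    | smul c a ha => rw [map_smul, smul_comm, ha, smul_zero]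
    | word w => rw [hG, H.smul_sortCost]
  have hword (w : List (Fin n)) : f (w.map y).prod = (w.map fun i => f (y i)).prod :=
    map_word (f : T →+* E) y w
  have hGr (u v) (i j : Fin n) :
      G (u * commDefect h c y i j * v) = f (u * commDefect h c y i j * v) := by
    induction u using induction_words hy with
    | zero => simp
    | add a b ha hb => simp only [add_mul, map_add, ha, hb]
    | smul c a ha => simp only [smul_mul_assoc, map_smul, ha]
    | word u =>
      induction v using induction_words hy with
      | zero => simp
      | add a b ha hb => simp only [mul_add, map_add, ha, hb]
      | smul c a ha => simp only [mul_smul_comm, map_smul, ha]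
      | word v =>
        have h1 := H.sortCost_append u v i j
        rw [← hG, ← hG, ← map_commDefect, ← hword, ← hword, ← map_mul, ← map_mul,
          ← sub_eq_iff_eq_add', ← map_sub] at h1
        -- G sees only the commutator part of the defect, because h • G = 0 removes the quadratic
        -- part.
        rw [← h1, commDefect, mul_sub, sub_mul, mul_smul_comm, smul_mul_assoc, map_sub,
          map_smul, hXG, sub_zero]
        congr 1
        simp only [List.map_append, List.prod_append, List.map_cons, List.prod_cons]
        noncomm_ring
  -- G is only linear, so the set where G = f need not be an ideal; this is the largest two-sided
  -- ideal inside it.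
  let J : TwoSidedIdeal T := .mk' {t | ∀ u v, G (u * t * v) = f (u * t * v)} (by simp)
    (fun {a b} ha hb u v => by simp only [mul_add, add_mul, map_add, ha u v, hb u v])
    (fun {a} ha u v => by simp only [mul_neg, neg_mul, map_neg, ha u v])
    (fun {a b} hb u v => by rw [← mul_assoc]; exact hb _ _)
    (fun {a b} ha u v => by rw [← mul_assoc, mul_assoc _ b]; exact ha _ _)
  refine ⟨G, hXG, fun t ht => ?_⟩
  have := ht J fun i j => (TwoSidedIdeal.mem_mk' ..).2 fun u v => hGr u v i j
  rw [TwoSidedIdeal.mem_mk'] at this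
  simpa using this 1 1

/-- The algebra with quadratic commutation relations satisfying the cyclic identity is free of
`h`-torsion. -/
theorem eq_zero_of_smul_eq_zero [IsDomain R] {A : Type*} [Ring A] [Algebra R A]
    (b : Module.Basis (List (Fin n)) R T) (hb : ∀ w, b w = (w.map y).prod)
    {c : Fin n → Fin n → Fin n → Fin n → R} (hc : IsCyclic c) {h : R} (hh : h ≠ 0) (q : T →ₐ[R] A)
    (hq : Function.Surjective q) (hq0 : ∀ i j, q (commDefect h c y i j) = 0)
    (hker : ∀ t, q t = 0 → ∀ J : TwoSidedIdeal T, (∀ i j, commDefect h c y i j ∈ J) → t ∈ J)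
    {a : A} (ha : h • a = 0) : a = 0 := by
  obtain ⟨t, rfl⟩ := hq a
  -- J = h · ker q, so h kills the defects in T/J.
  let J : TwoSidedIdeal T := .mk' {a | ∃ t, q t = 0 ∧ a = h • t} ⟨0, by simp⟩
    (by rintro _ _ ⟨a, ha, rfl⟩ ⟨b, hb, rfl⟩; exact ⟨a + b, by simp [ha, hb]⟩)
    (by rintro _ ⟨a, ha, rfl⟩; exact ⟨-a, by simp [ha]⟩)
    (by rintro b _ ⟨a, ha, rfl⟩; exact ⟨b * a, by simp [ha]⟩)
    (by rintro _ b ⟨a, ha, rfl⟩; exact ⟨a * b, by simp [ha]⟩)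
  obtain ⟨E, _, _, f, hf⟩ := exists_algHom_eq_zero_iff (S := R) J
  obtain ⟨G, hXG, hG⟩ := exists_linearMap_eq_on_defects b hb hc f fun i j => by
    rw [← map_smul, hf, TwoSidedIdeal.mem_mk']
    exact ⟨_, hq0 i j, rfl⟩
  rw [← map_smul] at ha
  have h1 : f (h • t) = 0 := by rw [← hG _ (hker _ ha), map_smul, hXG]
  rw [hf, TwoSidedIdeal.mem_mk'] at h1
  obtain ⟨t', ht', h3⟩ := h1
  -- T is free over a domain, so h cancels.
  have : t = t' := by
    apply b.repr.injective
    ext w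
    simpa [hh] using congrArg (fun s => b.repr s w) h3
  rw [this, ht']

end TorsionFree

end QuadraticPBW
end

noncomputable section

namespace QuadraticPBW

/-! ### Flat deformations and the descending filtration -/

section Deformation

variable {k : Type*} [Field k] {n : ℕ} {A : Type*} [Ring A] [Algebra k[X] A]

/-- A graded flat deformation over `k[ħ]` of the polynomial ring `k[x_1, …, x_n]`, generated by the
elements `x i` of degree one. -/
structure PolynomialDeformation (x : Fin n → A) where
  span_words : Submodule.span k[X] (Set.range fun w : List (Fin n) => (w.map x).prod) = ⊤
  X_torsionFree : ∀ a : A, (X : k[X]) • a = 0 → a = 0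
  commutator : ∀ i j, ∃ e : A, x i * x j = x j * x i + (X : k[X]) • e
  /-- reduction modulo `ħ` -/
  reduction : A →+* MvPolynomial (Fin n) k
  reduction_algebraMap : ∀ p : k[X], reduction (algebraMap k[X] A p) = MvPolynomial.C (p.eval 0)
  reduction_gen : ∀ i, reduction (x i) = MvPolynomial.X i
  /-- projection to the homogeneous component of degree `d` -/
  proj : ℕ → A →ₗ[k[X]] A
  proj_word : ∀ d (w : List (Fin n)),
    proj d (w.map x).prod = if w.length = d then (w.map x).prod else 0

namespace PolynomialDeformation

variable {x : Fin n → A} (D : PolynomialDeformation (k := k) x)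

theorem reduction_smul (p : k[X]) (a : A) : D.reduction (p • a) = p.eval 0 • D.reduction a := by
  rw [Algebra.smul_def, map_mul, D.reduction_algebraMap, MvPolynomial.smul_eq_C_mul]

theorem reduction_word (w : List (Fin n)) :
    D.reduction (w.map x).prod = MvPolynomial.monomial (Multiset.toFinsupp (w : Multiset (Fin n))) 1 := by
  induction w with
  | nil => simp
  | cons i w ih =>
    rw [List.map_cons, List.prod_cons, map_mul, ih, D.reduction_gen, ← Multiset.cons_coe,
      ← Multiset.singleton_add, map_add, MvPolynomial.X, MvPolynomial.monomial_mul]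
    simp

theorem reduction_surjective : Function.Surjective D.reduction := by
  intro p
  induction p using MvPolynomial.induction_on with
  | C c => exact ⟨algebraMap k[X] A (C c), by simp [D.reduction_algebraMap]⟩
  | add p q hp hq =>
    obtain ⟨a, rfl⟩ := hp
    obtain ⟨b, rfl⟩ := hq
    exact ⟨a + b, map_add _ _ _⟩
  | mul_X p i hp =>
    obtain ⟨a, rfl⟩ := hp
    exact ⟨a * x i, by rw [map_mul, D.reduction_gen]⟩

include D in
theorem exists_prod_eq_of_perm {w w' : List (Fin n)} (h : w.Perm w') :
    ∃ e : A, (w.map x).prod = (w'.map x).prod + (X : k[X]) • e := by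
  induction h with
  | nil => exact ⟨0, by simp⟩
  | cons i _ ih =>
    obtain ⟨e, he⟩ := ih
    exact ⟨x i * e, by simp [he, mul_add]⟩
  | swap i j w =>
    obtain ⟨e, he⟩ := D.commutator j i
    exact ⟨e * (w.map x).prod, by simp [← mul_assoc, he, add_mul]⟩
  | trans _ _ ih ih' =>
    obtain ⟨e, he⟩ := ih
    obtain ⟨e', he'⟩ := ih'
    exact ⟨e' + e, by rw [he, he', smul_add, add_assoc]⟩

/-- Choosing one word for each monomial gives a k-linear section σ of the reduction. Letters commute
modulo ħ, so every a is congruent to σ of its reduction modulo ħA. -/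
theorem reduction_eq_zero_iff {a : A} : D.reduction a = 0 ↔ ∃ e, a = (X : k[X]) • e := by
  constructor
  · let _ : Module k A := Module.compHom A (C : k →+* k[X])
    have hsmul (c : k) (a : A) : c • a = (C c : k[X]) • a := rfl
    let σ : MvPolynomial (Fin n) k →ₗ[k] A := (MvPolynomial.basisMonomials (Fin n) k).constr k
      fun m => ((Finsupp.toMultiset m).toList.map x).prod
    have key (a : A) : ∃ e, a = σ (D.reduction a) + (X : k[X]) • e := by
      induction a using induction_words D.span_words with
      | zero => exact ⟨0, by simp⟩
      | add a b ha hb =>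
        obtain ⟨e, he⟩ := ha
        obtain ⟨e', he'⟩ := hb
        refine ⟨e + e', ?_⟩
        rw [map_add, map_add, smul_add, add_add_add_comm, ← he, ← he']
      | smul p a ha =>
        obtain ⟨e, he⟩ := ha
        refine ⟨C (p.eval 0) • e + p.divX • a, ?_⟩
        have h1 : p • a = C (p.eval 0) • a + (X : k[X]) • p.divX • a := by
          rw [smul_smul, ← add_smul, ← coeff_zero_eq_eval_zero, add_comm, X_mul_divX_add]
        rw [D.reduction_smul, map_smul, hsmul, smul_add, smul_comm _ (C _), ← add_assoc, ← smul_add,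
          ← he, h1]
      | word w =>
        have h1 : σ (D.reduction (w.map x).prod) = ((w : Multiset (Fin n)).toList.map x).prod := by
          have h2 := (MvPolynomial.basisMonomials (Fin n) k).constr_basis k
            (fun m => ((Finsupp.toMultiset m).toList.map x).prod) (Multiset.toFinsupp w)
          rw [MvPolynomial.coe_basisMonomials, Multiset.toFinsupp_toMultiset] at h2
          rw [D.reduction_word]
          exact h2
        rw [h1]
        exact D.exists_prod_eq_of_perm (Multiset.coe_eq_coe.1 (Multiset.coe_toList _).symm)
    intro ha
    obtain ⟨e, he⟩ := key a
    exact ⟨e, by rw [he, ha, map_zero, zero_add]⟩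
  · rintro ⟨e, rfl⟩
    simp [D.reduction_smul]

include D in
theorem X_pow_smul_eq_zero {l : ℕ} {a : A} (h : (X ^ l : k[X]) • a = 0) : a = 0 := by
  induction l with
  | zero => simpa using h
  | succ l ih => exact ih (D.X_torsionFree _ (by rwa [smul_smul, ← pow_succ']))

end PolynomialDeformation

section Graded

variable (k A) in
/-- The map `A → Γ_0/Γ_1` into the associated graded ring. -/
def grZero : A →+* Gr k A where
  toFun a := DirectSum.of (GrGam k A) 0 (symb 0 ⟨a, mem_Gam_zero a⟩)
  map_one' := rfl
  map_zero' := map_zero (DirectSum.of (GrGam k A) 0)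
  map_add' a b := map_add (DirectSum.of (GrGam k A) 0) (symb 0 ⟨a, mem_Gam_zero a⟩) (symb 0 ⟨b, mem_Gam_zero b⟩)
  map_mul' a b := by
    rw [DirectSum.of_mul_of]
    exact DirectSum.of_eq_of_gradedMonoid_eq (mk_symb_congr (zero_add 0).symm _ _ rfl)

theorem grZero_X_smul (a : A) : grZero k A ((X : k[X]) • a) = 0 := by
  change DirectSum.of (GrGam k A) 0 (symb 0 _) = 0
  rw [← map_zero (DirectSum.of (GrGam k A) 0)]
  congr 1
  change symb 0 _ = symb 0 0
  rw [symb_eq]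
  exact mem_Gam.2 ⟨a, by simp⟩

theorem grZero_mul_grHbar_pow (a : A) (l : ℕ) : grZero k A a * grHbar k A ^ l =
    DirectSum.of (GrGam k A) l (symb l ⟨(X ^ l : k[X]) • a, mem_Gam.2 ⟨a, rfl⟩⟩) := by
  induction l with
  | zero =>
    rw [pow_zero, mul_one]
    exact DirectSum.of_eq_of_gradedMonoid_eq (mk_symb_congr rfl _ _ (by simp))
  | succ l ih =>
    rw [pow_succ, ← mul_assoc, ih]
    change DirectSum.of (GrGam k A) l _ * DirectSum.of (GrGam k A) 1 _ = _
    rw [DirectSum.of_mul_of]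
    refine DirectSum.of_eq_of_gradedMonoid_eq (mk_symb_congr rfl _ _ ?_)
    change (X ^ l : k[X]) • a * algebraMap k[X] A X = _
    rw [← Algebra.commutes, ← Algebra.smul_def, smul_smul, ← pow_succ']

theorem grZero_commute_grHbar (a : A) : Commute (grZero k A a) (grHbar k A) := by
  change DirectSum.of (GrGam k A) 0 _ * DirectSum.of (GrGam k A) 1 _ =
    DirectSum.of (GrGam k A) 1 _ * DirectSum.of (GrGam k A) 0 _
  rw [DirectSum.of_mul_of, DirectSum.of_mul_of]
  refine DirectSum.of_eq_of_gradedMonoid_eq (mk_symb_congr (by omega) _ _ ?_)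
  exact (Algebra.commutes _ _).symm

end Graded

namespace PolynomialDeformation

variable {x : Fin n → A} (D : PolynomialDeformation (k := k) x)

include D in
theorem descendingPBW : DescendingPBW k A n := by
  obtain ⟨ψ, hψ⟩ : ∃ ψ : MvPolynomial (Fin n) k →+* Gr k A,
      ∀ a, ψ (D.reduction a) = grZero k A a := by
    have hker : RingHom.ker D.reduction ≤ RingHom.ker (grZero k A) := fun a ha => by
      obtain ⟨e, rfl⟩ := D.reduction_eq_zero_iff.1 ((RingHom.mem_ker).1 ha)
      exact grZero_X_smul e
    exact ⟨D.reduction.liftOfSurjective D.reduction_surjective ⟨grZero k A, hker⟩, fun a =>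
      RingHom.liftOfRightInverse_comp_apply _ _ _ ⟨grZero k A, hker⟩ a⟩
  have hcomm (p) : Commute (ψ p) (grHbar k A) := by
    obtain ⟨a, rfl⟩ := D.reduction_surjective p
    rw [hψ]
    exact grZero_commute_grHbar a
  let Φ : (MvPolynomial (Fin n) k)[X] →+* Gr k A := eval₂RingHom' ψ (grHbar k A) hcomm
  have hΦ (l : ℕ) (a : A) : Φ (monomial l (D.reduction a)) =
      DirectSum.of (GrGam k A) l (symb l ⟨(X ^ l : k[X]) • a, mem_Gam.2 ⟨a, rfl⟩⟩) := by
    rw [← grZero_mul_grHbar_pow, ← hψ]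
    exact eval₂_monomial _ _
  -- Φ is graded, so injectivity can be tested in each degree.
  have hcoeff (f) (l : ℕ) : Φ f l = Φ (monomial l (f.coeff l)) l := by
    induction f using Polynomial.induction_on' with
    | add f g hf hg => rw [map_add, DirectSum.add_apply, hf, hg, coeff_add, map_add, map_add,
        DirectSum.add_apply]
    | monomial j p =>
      by_cases hjl : j = l
      · rw [hjl, coeff_monomial_same]
      · rw [coeff_monomial_of_ne _ (Ne.symm hjl), map_zero, map_zero]
        obtain ⟨a, rfl⟩ := D.reduction_surjective p
        rw [hΦ, DirectSum.of_eq_of_ne _ _ _ (Ne.symm hjl)]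
        rfl
  have hinj : Function.Injective Φ := by
    rw [injective_iff_map_eq_zero]
    intro f hf
    ext1 l
    obtain ⟨a, ha⟩ := D.reduction_surjective (f.coeff l)
    have h1 := hcoeff f l
    rw [hf, ← ha, hΦ, DirectSum.of_eq_same] at h1
    have h2 : symb l ⟨(X ^ l : k[X]) • a, mem_Gam.2 ⟨a, rfl⟩⟩ = symb l 0 := h1.symm
    rw [symb_eq] at h2
    obtain ⟨e, he⟩ := mem_Gam.1 h2
    rw [coeff_zero, ← ha, D.reduction_eq_zero_iff]
    -- From ħ^l a = ħ^(l+1) e, cancelling ħ^l leaves a = ħe.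
    refine ⟨e, sub_eq_zero.1 (D.X_pow_smul_eq_zero (l := l) ?_)⟩
    rw [smul_sub, smul_smul, ← pow_succ, he]
    simp
  have hof (l : ℕ) (y : GrGam k A l) : ∃ p, Φ (monomial l p) = DirectSum.of (GrGam k A) l y := by
    obtain ⟨⟨_, b, rfl⟩, rfl⟩ := symb_surjective l y
    exact ⟨D.reduction b, hΦ l b⟩
  have hsurj : Function.Surjective Φ := by
    intro z
    induction z using DirectSum.induction_on with
    | zero => exact ⟨0, map_zero _⟩
    | of l y => exact (hof l y).imp' _ fun _ => id
    | add z z' hz hz' =>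
      obtain ⟨f, rfl⟩ := hz
      obtain ⟨g, rfl⟩ := hz'
      exact ⟨f + g, map_add _ _ _⟩
  refine ⟨RingEquiv.ofBijective Φ ⟨hinj, hsurj⟩, ?_, fun l => ?_⟩
  · refine Polynomial.ringHom_ext (fun c => ?_) ?_
    · have h1 : (MvPolynomial.C c : MvPolynomial (Fin n) k) =
          D.reduction (algebraMap k[X] A (C c)) := by simp [D.reduction_algebraMap]
      change Φ (Polynomial.map MvPolynomial.C (C c)) = eval₂ _ _ (C c)
      rw [map_C, eval₂_C, h1]
      exact (eval₂_C _ _).trans (hψ _)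
    · change Φ (Polynomial.map _ X) = eval₂RingHom' _ _ _ X
      simp [Φ]
  · ext z
    constructor
    · rintro ⟨_, ⟨p, rfl⟩, rfl⟩
      obtain ⟨a, rfl⟩ := D.reduction_surjective p
      exact ⟨_, (hΦ l a).symm⟩
    · rintro ⟨y, rfl⟩
      obtain ⟨p, hp⟩ := hof l y
      exact ⟨_, ⟨p, rfl⟩, hp⟩

end PolynomialDeformation

end Deformation

end QuadraticPBW
end

noncomputable section

namespace QuadraticPBW

/-! ### Fibre dimension and generic rank over k[ħ] -/

section Rank

variable {k : Type*} [Field k] {M W : Type*} [AddCommGroup M] [Module k[X] M] [AddCommGroup W]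
  [Module k W]

/-- Lifts of a basis of a fibre of a module over `k[X]` without torsion at that point are linearly
independent. -/
theorem linearIndependent_of_fiber {c : k} (htf : ∀ m : M, (X - C c) • m = 0 → m = 0)
    (f : M →ₛₗ[evalRingHom c] W) {ι : Type*} {u : ι → M} (hu : LinearIndependent k (f ∘ u)) :
    LinearIndependent k[X] u := by
  classical
  rw [linearIndependent_iff']
  intro s
  -- In the fibre every coefficient of a relation vanishes at c. Absence of torsion lets the
  -- relation be divided by X - c, and the descent repeats.
  have key (N : ℕ) : ∀ p : ι → k[X], ∑ i ∈ s, p i • u i = 0 → ∀ i ∈ s, (X - C c) ^ N ∣ p i := by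
    induction N with
    | zero => simp
    | succ N ih =>
      intro p hp
      have h1 (i) (hi : i ∈ s) : (X - C c) ∣ p i := by
        have := congrArg f hp
        simp only [map_sum, LinearMap.map_smulₛₗ, map_zero] at this
        exact dvd_iff_isRoot.2 (linearIndependent_iff'.1 hu s _ this i hi)
      choose! q hq using h1
      have h2 : ∑ i ∈ s, q i • u i = 0 := by
        apply htf
        rw [Finset.smul_sum, ← hp]
        exact Finset.sum_congr rfl fun i hi => by rw [smul_smul, ← hq i hi]
      intro i hi
      rw [hq i hi, pow_succ']
      exact mul_dvd_mul_left _ (ih q h2 i hi)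
  intro p hp i hi
  by_contra h0
  have h1 := key ((p i).natDegree + 1) p hp i hi
  have h2 := natDegree_le_of_dvd h1 h0
  rw [natDegree_pow, natDegree_X_sub_C] at h2
  omega

/-- The fibre at `c` of a finitely generated module over `k[X]` without torsion at `c` has the
dimension of the generic fibre. -/
theorem finrank_fiber [Module.Finite k[X] M] {c : k} (htf : ∀ m : M, (X - C c) • m = 0 → m = 0)
    (f : M →ₛₗ[evalRingHom c] W) (hf : Function.Surjective f)
    (hker : ∀ m, f m = 0 → ∃ m', m = (X - C c) • m') :
    Module.Finite k W ∧ Module.finrank k W = Module.finrank k[X] M := by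
  have : RingHomSurjective (evalRingHom c) := ⟨fun a => ⟨C a, by simp⟩⟩
  have hfin : Module.Finite k W := Module.Finite.of_surjective f hf
  refine ⟨hfin, ?_⟩
  let b := Module.finBasis k W
  choose u hu using fun i => hf (b i)
  have hli : LinearIndependent k[X] u := by
    refine linearIndependent_of_fiber htf f ?_
    convert b.linearIndependent using 1
    exact funext hu
  set N := Submodule.span k[X] (Set.range u)
  -- The lifts span M modulo X - c. Nakayama then makes M/N torsion, so N has the full rank even if
  -- M has torsion at other points.
  have hle : (⊤ : Submodule k[X] (M ⧸ N)) ≤ Ideal.span {X - C c} • ⊤ := by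
    rintro z -
    obtain ⟨m, rfl⟩ := Submodule.Quotient.mk_surjective _ z
    have h1 : f (m - ∑ i, C (b.repr (f m) i) • u i) = 0 := by
      simp only [map_sub, map_sum, LinearMap.map_smulₛₗ, hu]
      simp [b.sum_repr]
    obtain ⟨m', hm'⟩ := hker _ h1
    have h2 : (Submodule.Quotient.mk m : M ⧸ N) = (X - C c) • Submodule.Quotient.mk m' := by
      rw [← Submodule.Quotient.mk_smul, Submodule.Quotient.eq, ← hm', sub_sub_cancel]
      exact Submodule.sum_mem _ fun i _ =>
        Submodule.smul_mem _ _ (Submodule.subset_span ⟨i, rfl⟩)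
    rw [h2]
    exact Submodule.smul_mem_smul (Ideal.mem_span_singleton_self _) trivial
  obtain ⟨r, hr, hr0⟩ := Submodule.exists_sub_one_mem_and_smul_eq_zero_of_fg_of_le_smul
    _ _ Module.Finite.fg_top hle
  have hrne : r ≠ 0 := by
    rintro rfl
    obtain ⟨p, hp⟩ := Ideal.mem_span_singleton.1 hr
    have := congrArg (eval c) hp
    simp at this
  have hrank : Module.rank k[X] (M ⧸ N) = 0 := by
    rw [rank_eq_zero_iff]
    exact fun z => ⟨r, hrne, hr0 z trivial⟩
  have h3 := rank_quotient_add_rank_of_isDomain N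
  rw [hrank, zero_add, rank_span hli] at h3
  rw [Module.finrank.eq_1 k[X] M, ← h3, ← Nat.card,
    ← Nat.card_congr (Equiv.ofInjective u hli.injective), Nat.card_fin]

end Rank

end QuadraticPBW
end

noncomputable section

namespace QuadraticPBW

/-! ### Homogeneous components, exceptional points and fibres -/

namespace PolynomialDeformation

variable {k : Type*} [Field k] {n : ℕ} {A : Type*} [Ring A] [Algebra k[X] A] {x : Fin n → A}
  (D : PolynomialDeformation (k := k) x)

/-- The homogeneous component of degree `d`. -/
def component (d : ℕ) : Submodule k[X] A :=
  LinearMap.range (D.proj d)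

theorem proj_proj (d : ℕ) (a : A) : D.proj d (D.proj d a) = D.proj d a := by
  induction a using induction_words D.span_words with
  | zero => simp
  | add a b ha hb => simp only [map_add, ha, hb]
  | smul c a ha => simp only [map_smul, ha]
  | word w =>
    rw [D.proj_word]
    split_ifs with h
    · rw [D.proj_word, if_pos h]
    · rw [map_zero]

theorem proj_of_mem {d : ℕ} {a : A} (ha : a ∈ D.component d) : D.proj d a = a := by
  obtain ⟨b, rfl⟩ := ha
  exact D.proj_proj d b

theorem word_mem_component (w : List (Fin n)) : (w.map x).prod ∈ D.component w.length :=
  ⟨(w.map x).prod, by rw [D.proj_word, if_pos rfl]⟩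

theorem eq_sum_proj (a : A) : ∃ N, ∀ N' ≥ N, a = ∑ d ∈ Finset.range N', D.proj d a := by
  induction a using induction_words D.span_words with
  | zero => exact ⟨0, by simp⟩
  | add a b ha hb =>
    obtain ⟨N, hN⟩ := ha
    obtain ⟨N', hN'⟩ := hb
    refine ⟨max N N', fun M hM => ?_⟩
    simp only [map_add, Finset.sum_add_distrib]
    rw [← hN M (le_of_max_le_left hM), ← hN' M (le_of_max_le_right hM)]
  | smul c a ha =>
    obtain ⟨N, hN⟩ := ha
    refine ⟨N, fun M hM => ?_⟩
    simp only [map_smul, ← Finset.smul_sum]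
    rw [← hN M hM]
  | word w =>
    refine ⟨w.length + 1, fun M hM => ?_⟩
    simp only [D.proj_word]
    rw [Finset.sum_ite_eq, if_pos (Finset.mem_range.2 hM)]

instance finite_component (d : ℕ) : Module.Finite k[X] (D.component d) := by
  rw [Module.Finite.iff_fg]
  refine ⟨((List.finite_length_eq (Fin n) d).image fun w => (w.map x).prod).toFinset, ?_⟩
  rw [Set.Finite.coe_toFinset]
  apply le_antisymm
  · rw [Submodule.span_le]
    rintro _ ⟨w, rfl, rfl⟩
    exact D.word_mem_component w
  · rintro _ ⟨a, rfl⟩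
    induction a using induction_words D.span_words with
    | zero => simp
    | add a b ha hb => rw [map_add]; exact add_mem ha hb
    | smul c a ha => rw [map_smul]; exact Submodule.smul_mem _ _ ha
    | word w =>
      rw [D.proj_word]
      split_ifs with h
      · exact Submodule.subset_span ⟨w, h, rfl⟩
      · exact zero_mem _

/-! ### The module `⋂ ħ^ℓ A` -/

theorem mem_GamInf {a : A} : a ∈ GamInf k A ↔ ∀ l : ℕ, ∃ b, a = (X ^ l : k[X]) • b := by
  simp only [GamInf, Submodule.mem_iInf, mem_Gam, eq_comm]

/-- The intersection N of ⋂Γ_ℓ with a component satisfies N = ħN, since ħ can be cancelled. As N is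
finitely generated, Nakayama gives p ≡ 1 mod ħ killing it. -/
theorem exists_smul_GamInf_component_eq_zero (d : ℕ) :
    ∃ p : k[X], p ≠ 0 ∧ ∀ a ∈ GamInf k A, p • D.proj d a = 0 := by
  let N : Submodule k[X] (D.component d) := (GamInf k A).submoduleOf (D.component d)
  have hN : N ≤ Ideal.span {(X : k[X])} • N := by
    rintro ⟨a, ha⟩ haN
    have haN' : a ∈ GamInf k A := haN
    obtain ⟨b, hb⟩ := mem_GamInf.1 haN' 1
    rw [pow_one] at hb
    have h1 : a = (X : k[X]) • D.proj d b := by rw [← map_smul, ← hb, D.proj_of_mem ha]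
    have h2 : D.proj d b ∈ GamInf k A := mem_GamInf.2 fun l => by
      obtain ⟨e, he⟩ := mem_GamInf.1 haN' (l + 1)
      refine ⟨e, sub_eq_zero.1 (D.X_torsionFree _ ?_)⟩
      rw [smul_sub, ← h1, smul_smul, ← pow_succ', he, sub_self]
    have h3 : (⟨a, ha⟩ : D.component d) = (X : k[X]) • ⟨D.proj d b, b, rfl⟩ := Subtype.ext h1
    rw [h3]
    exact Submodule.smul_mem_smul (Ideal.mem_span_singleton_self _) h2
  obtain ⟨p, hp, hp0⟩ := Submodule.exists_sub_one_mem_and_smul_eq_zero_of_fg_of_le_smul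
    _ N (IsNoetherian.noetherian N) hN
  refine ⟨p, ?_, fun a ha => ?_⟩
  · rintro rfl
    obtain ⟨q, hq⟩ := Ideal.mem_span_singleton.1 hp
    have := congrArg (eval 0) hq
    simp at this
  · have h1 : D.proj d a ∈ GamInf k A := mem_GamInf.2 fun l => by
      obtain ⟨b, rfl⟩ := mem_GamInf.1 ha l
      exact ⟨D.proj d b, map_smul _ _ _⟩
    exact congrArg Subtype.val (hp0 ⟨D.proj d a, a, rfl⟩ h1)

include D in
-- An element of ⋂Γ_ℓ has finitely many components, so a finite product of the annihilating
-- polynomials kills it. An exceptional point is a root of one factor.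
theorem countable_exceptionalSet : (exceptionalSet k A).Countable := by
  classical
  choose p hp0 hp using D.exists_smul_GamInf_component_eq_zero
  refine (Set.countable_iUnion fun d => ((p d).roots.toFinset.finite_toSet).countable).mono ?_
  intro a ha
  obtain ⟨m, hm⟩ := Module.mem_support_iff_exists_annihilator.1 ha
  obtain ⟨N, hN⟩ := D.eq_sum_proj m
  have h1 : ∏ d ∈ Finset.range N, p d ∈ (Submodule.span k[X] {m}).annihilator := by
    rw [Submodule.mem_annihilator_span_singleton]
    apply Subtype.ext
    rw [Submodule.coe_smul, hN N le_rfl, Finset.smul_sum]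
    refine Finset.sum_eq_zero fun d hd => ?_
    rw [← Finset.prod_erase_mul _ _ hd, mul_smul, hp d _ m.2, smul_zero]
  have h2 : (X - C a) ∣ ∏ d ∈ Finset.range N, p d := Ideal.mem_span_singleton.1 (hm h1)
  obtain ⟨d, -, hd⟩ := (prime_X_sub_C a).exists_mem_finset_dvd h2
  exact Set.mem_iUnion.2 ⟨d, by simpa [hp0 d] using dvd_iff_isRoot.1 hd⟩

include D in
theorem X_sub_C_torsionFree {c : k} (hc : c ∉ exceptionalSet k A) {a : A}
    (ha : (X - C c) • a = 0) : a = 0 := by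
  obtain rfl | hc0 := eq_or_ne c 0
  · exact D.X_torsionFree a (by simpa using ha)
  · by_contra ha0
    have hinf : a ∈ GamInf k A := mem_GamInf.2 fun l => by
      -- From uħ^l + v(ħ - c) = 1 and (ħ - c)a = 0 follows a = ħ^l u a, so a lies in every Γ_ℓ.
      obtain ⟨u, v, huv⟩ : IsCoprime (X ^ l : k[X]) (X - C c) := by
        have := isCoprime_X_sub_C_of_isUnit_sub (R := k) (a := 0) (b := c) (by simpa using hc0)
        rw [C_0, sub_zero] at this
        exact this.pow_left
      refine ⟨u • a, ?_⟩
      rw [smul_smul, mul_comm]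
      nth_rw 1 [← one_smul k[X] a, ← huv, add_smul, mul_smul v, ha, smul_zero, add_zero]
    refine hc (Module.mem_support_iff_exists_annihilator.2 ⟨⟨a, hinf⟩, fun p hp => ?_⟩)
    rw [Submodule.mem_annihilator_span_singleton] at hp
    have hpa : p • a = 0 := congrArg Subtype.val hp
    refine Ideal.mem_span_singleton.2 (dvd_iff_isRoot.2 ?_)
    by_contra hroot
    apply ha0
    -- k[ħ] acts on a through evaluation at c, so only multiples of ħ - c annihilate a ≠ 0, and c
    -- would be exceptional.
    have h1 : p • a = (C (p.eval c) : k[X]) • a := by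
      obtain ⟨q, hq⟩ := X_sub_C_dvd_sub_C_eval (p := p) (a := c)
      rw [← sub_eq_zero, ← sub_smul, hq, mul_comm, mul_smul, ha, smul_zero]
    rw [hpa] at h1
    rw [← one_smul k[X] a, ← C_1, ← inv_mul_cancel₀ hroot, C_mul, mul_smul, ← h1, smul_zero]

/-! ### The fibres of the homogeneous components -/

theorem reduction_proj (d : ℕ) (a : A) :
    D.reduction (D.proj d a) = MvPolynomial.homogeneousComponent d (D.reduction a) := by
  induction a using induction_words D.span_words with
  | zero => simp
  | add a b ha hb => simp only [map_add, ha, hb]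
  | smul c a ha => rw [map_smul, D.reduction_smul, D.reduction_smul, map_smul, ha]
  | word w =>
    have hw : (D.reduction (w.map x).prod).IsHomogeneous w.length := by
      clear * -
      induction w with
      | nil => simpa using MvPolynomial.isHomogeneous_one (Fin n) k
      | cons i w ih =>
        rw [List.map_cons, List.prod_cons, map_mul, D.reduction_gen, List.length_cons, add_comm]
        exact (MvPolynomial.isHomogeneous_X k i).mul ih
    rw [D.proj_word, MvPolynomial.homogeneousComponent_of_mem hw]
    split_ifs with h h' h'
    · rfl
    · exact absurd h.symm h'
    · exact absurd h'.symm h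
    · rw [map_zero]

theorem finrank_homogeneousSubmodule (d : ℕ) :
    Module.Finite k (MvPolynomial.homogeneousSubmodule (Fin n) k d) ∧
      Module.finrank k (MvPolynomial.homogeneousSubmodule (Fin n) k d) =
        Module.finrank k[X] (D.component d) := by
  let f : D.component d →ₛₗ[evalRingHom (0 : k)] MvPolynomial.homogeneousSubmodule (Fin n) k d :=
    { toFun m := ⟨D.reduction m, by
        rw [← D.proj_of_mem m.2, D.reduction_proj]
        exact MvPolynomial.homogeneousComponent_mem _ _⟩
      map_add' a b := Subtype.ext (map_add D.reduction _ _)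
      map_smul' p a := Subtype.ext (D.reduction_smul p a) }
  refine finrank_fiber (c := 0) (fun m hm => ?_) f ?_ fun m hm => ?_
  · rw [C_0, sub_zero] at hm
    exact Subtype.ext (D.X_torsionFree _ (congrArg Subtype.val hm))
  · rintro ⟨p, hp⟩
    obtain ⟨a, rfl⟩ := D.reduction_surjective p
    refine ⟨⟨D.proj d a, a, rfl⟩, Subtype.ext ?_⟩
    change D.reduction (D.proj d a) = _
    rw [D.reduction_proj, MvPolynomial.homogeneousComponent_of_mem hp, if_pos rfl]
  · obtain ⟨e, he⟩ := D.reduction_eq_zero_iff.1 (congrArg Subtype.val hm)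
    refine ⟨⟨D.proj d e, e, rfl⟩, Subtype.ext ?_⟩
    rw [C_0, sub_zero, Submodule.coe_smul, ← map_smul, ← he, D.proj_of_mem m.2]

section Specialization

variable {B : Type*} [Ring B] [Algebra k B] {c : k} (ρ : A →+* B)
  (hρ : ∀ p : k[X], ρ (algebraMap k[X] A p) = algebraMap k B (p.eval c))

include hρ in
theorem map_smul_of_algebraMap (p : k[X]) (a : A) : ρ (p • a) = p.eval c • ρ a := by
  rw [Algebra.smul_def, map_mul, hρ, Algebra.smul_def]

include hρ in
theorem map_mem_Fil {d : ℕ} {a : A} (ha : a ∈ D.component d) :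
    ρ a ∈ Fil k (fun i => ρ (x i)) d := by
  obtain ⟨a, rfl⟩ := ha
  induction a using induction_words D.span_words with
  | zero => simp
  | add a b ha hb => rw [map_add, map_add]; exact add_mem ha hb
  | smul p a ha =>
    rw [map_smul, map_smul_of_algebraMap ρ hρ]
    exact Submodule.smul_mem _ _ ha
  | word w =>
    rw [D.proj_word]
    split_ifs with h
    · exact Submodule.subset_span ⟨w, by rw [h], map_word ρ x w⟩
    · rw [map_zero]
      exact zero_mem _

include hρ in
theorem exists_sub_mem_Fil {d : ℕ} {b : B} (hb : b ∈ Fil k (fun i => ρ (x i)) d) :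
    ∃ a ∈ D.component d, b - ρ a ∈ Fil k (fun i => ρ (x i)) ((d : ℤ) - 1) := by
  induction hb using Submodule.span_induction with
  | mem b hb =>
    obtain ⟨w, hw, rfl⟩ := hb
    by_cases h : w.length = d
    · refine ⟨_, h ▸ D.word_mem_component w, ?_⟩
      rw [map_word, sub_self]
      exact zero_mem _
    · refine ⟨0, zero_mem _, ?_⟩
      rw [map_zero, sub_zero]
      exact Submodule.subset_span ⟨w, by omega, rfl⟩
  | zero => exact ⟨0, zero_mem _, by simp⟩
  | add b b' _ _ hb hb' =>
    obtain ⟨a, ha, h⟩ := hb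
    obtain ⟨a', ha', h'⟩ := hb'
    refine ⟨a + a', add_mem ha ha', ?_⟩
    rw [map_add, add_sub_add_comm]
    exact add_mem h h'
  | smul s b _ hb =>
    obtain ⟨a, ha, h⟩ := hb
    refine ⟨(C s : k[X]) • a, Submodule.smul_mem _ _ ha, ?_⟩
    rw [map_smul_of_algebraMap ρ hρ, eval_C, ← smul_sub]
    exact Submodule.smul_mem _ _ h

include hρ in
-- Words shorter than d have no component of degree d; this is all that the kernel computation in
-- `isPBW` needs from the lower filtration step.
theorem exists_eq_of_mem_Fil {d : ℕ} {b : B} (hb : b ∈ Fil k (fun i => ρ (x i)) ((d : ℤ) - 1)) :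
    ∃ a, D.proj d a = 0 ∧ ρ a = b := by
  induction hb using Submodule.span_induction with
  | mem b hb =>
    obtain ⟨w, hw, rfl⟩ := hb
    exact ⟨(w.map x).prod, by rw [D.proj_word, if_neg (by omega)], map_word ρ x w⟩
  | zero => exact ⟨0, map_zero _, map_zero _⟩
  | add b b' _ _ hb hb' =>
    obtain ⟨a, ha, rfl⟩ := hb
    obtain ⟨a', ha', rfl⟩ := hb'
    exact ⟨a + a', by rw [map_add, ha, ha', add_zero], map_add _ _ _⟩
  | smul s b _ hb =>
    obtain ⟨a, ha, rfl⟩ := hb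
    exact ⟨(C s : k[X]) • a, by rw [map_smul, ha, smul_zero],
      by rw [map_smul_of_algebraMap ρ hρ, eval_C]⟩

include D hρ in
/-- A fibre of a polynomial deformation outside of the exceptional set is a PBW algebra. -/
theorem isPBW (hker : ∀ a, ρ a = 0 → ∃ e, a = (X - C c) • e) (hc : c ∉ exceptionalSet k A) :
    IsPBW k fun i => ρ (x i) := by
  intro d
  let ρl : A →ₛₗ[evalRingHom c] B :=
    { toFun := ρ
      map_add' := map_add ρ
      map_smul' := map_smul_of_algebraMap ρ hρ }
  let f := (Submodule.mkQ ((Fil k (fun i => ρ (x i)) ((d : ℤ) - 1)).submoduleOf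
    (Fil k (fun i => ρ (x i)) d))).comp
      ((ρl.domRestrict (D.component d)).codRestrict (Fil k (fun i => ρ (x i)) d)
        fun a => D.map_mem_Fil ρ hρ a.2)
  obtain ⟨_, h1⟩ := finrank_fiber (c := c)
    (fun m hm => Subtype.ext (D.X_sub_C_torsionFree hc (congrArg Subtype.val hm))) f (by
      intro z
      obtain ⟨⟨b, hb⟩, rfl⟩ := Submodule.Quotient.mk_surjective _ z
      obtain ⟨a, ha, h⟩ := D.exists_sub_mem_Fil ρ hρ hb
      exact ⟨⟨a, ha⟩, Eq.symm ((Submodule.Quotient.eq _).2 h)⟩) (by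
      intro m hm
      obtain ⟨a, ha, h⟩ := D.exists_eq_of_mem_Fil ρ hρ
        (b := ρ m) ((Submodule.Quotient.mk_eq_zero ((Fil k (fun i => ρ (x i)) ((d : ℤ) - 1)).submoduleOf
          (Fil k (fun i => ρ (x i)) d))).1 hm)
      -- Projecting m - a = (ħ - c)e to degree d removes a and leaves m = (ħ - c) · `proj d e`.
      obtain ⟨e, he⟩ := hker (m - a) (by rw [map_sub, h, sub_self])
      refine ⟨⟨D.proj d e, e, rfl⟩, Subtype.ext ?_⟩
      rw [Submodule.coe_smul, ← map_smul, ← he, map_sub, ha, sub_zero, D.proj_of_mem m.2])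
  obtain ⟨_, h2⟩ := D.finrank_homogeneousSubmodule d
  exact FiniteDimensional.nonempty_linearEquiv_of_finrank_eq (h1.trans h2.symm)

end Specialization

end PolynomialDeformation

end QuadraticPBW
end

noncomputable section

namespace QuadraticPBW

/-! ### Presentations by quadratic relations -/

section Presentation

variable {n : ℕ} {R T A : Type*} [CommRing R] [Ring T] [Algebra R T] [Ring A] [Algebra R A]

/-- The map `q` is the quotient of `T` by the two-sided ideal generated by the defects of the
quadratic commutation relations between the `y i`. -/
structure IsQuadraticQuotient (h : R) (c : Fin n → Fin n → Fin n → Fin n → R) (y : Fin n → T)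
    (q : T →ₐ[R] A) : Prop where
  surjective : Function.Surjective q
  map_defect : ∀ i j, q (commDefect h c y i j) = 0
  mem_of_map_eq_zero : ∀ t, q t = 0 →
    ∀ J : TwoSidedIdeal T, (∀ i j, commDefect h c y i j ∈ J) → t ∈ J

namespace IsQuadraticQuotient

variable {h : R} {c : Fin n → Fin n → Fin n → Fin n → R} {y : Fin n → T} {q : T →ₐ[R] A}
  (Q : IsQuadraticQuotient h c y q)
include Q

theorem commDefect_eq_zero (i j : Fin n) : commDefect h c (fun i => q (y i)) i j = 0 := by
  rw [← map_commDefect, Q.map_defect]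

theorem exists_lift {B : Type*} [Ring B] [Algebra R B] (f : T →ₐ[R] B)
    (hf : ∀ i j, commDefect h c (fun i => f (y i)) i j = 0) :
    ∃ g : A →ₐ[R] B, ∀ t, g (q t) = f t := by
  have hker : RingHom.ker (q : T →+* A) ≤ RingHom.ker (f : T →+* B) := fun t ht => by
    have := Q.mem_of_map_eq_zero t ht (TwoSidedIdeal.ker f) fun i j => by
      rw [TwoSidedIdeal.mem_ker, map_commDefect, hf]
    exact (TwoSidedIdeal.mem_ker f).1 this
  let g : A →+* B := (q : T →+* A).liftOfSurjective Q.surjective ⟨f, hker⟩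
  have hg (t) : g (q t) = f t :=
    RingHom.liftOfRightInverse_comp_apply _ _ _ ⟨(f : T →+* B), hker⟩ t
  have hg' (r : R) : g (algebraMap R A r) = algebraMap R B r := by
    rw [← q.commutes, hg, f.commutes]
  exact ⟨{ g with commutes' := hg' }, hg⟩

theorem span_words (b : Module.Basis (List (Fin n)) R T) (hb : ∀ w, b w = (w.map y).prod) :
    Submodule.span R (Set.range fun w : List (Fin n) => (w.map fun i => q (y i)).prod) = ⊤ := by
  rw [eq_top_iff]
  rintro a -
  obtain ⟨t, rfl⟩ := Q.surjective a
  have ht : t ∈ Submodule.span R (Set.range b) := by rw [b.span_eq]; trivial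
  induction ht using Submodule.span_induction with
  | mem t ht =>
    obtain ⟨w, rfl⟩ := ht
    rw [hb]
    exact Submodule.subset_span ⟨w, (map_word (q : T →+* A) y w).symm⟩
  | zero => rw [map_zero]; exact zero_mem _
  | add a b _ _ ha hb => rw [map_add]; exact add_mem ha hb
  | smul c a _ ha => rw [map_smul]; exact Submodule.smul_mem _ _ ha

/-- The homogeneous components of the quotient of a free algebra by quadratic relations, obtained from
the coaction `x_i ↦ x_i t`. -/
theorem exists_proj (hT : ∀ (z : Fin n → A[X]), ∃ f : T →ₐ[R] A[X], ∀ i, f (y i) = z i) :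
    ∃ proj : ℕ → A →ₗ[R] A, ∀ d (w : List (Fin n)),
      proj d (w.map fun i => q (y i)).prod =
        if w.length = d then (w.map fun i => q (y i)).prod else 0 := by
  obtain ⟨f₀, hf₀⟩ := hT fun i => monomial 1 (q (y i))
  obtain ⟨f, hf⟩ := Q.exists_lift f₀ fun i j => by
    -- The relations are homogeneous of degree 2, so the coaction multiplies them by t².
    have h1 : commDefect h c (fun i => f₀ (y i)) i j =
        monomial 2 (commDefect h c (fun i => q (y i)) i j) := by
      simp only [hf₀, commDefect, quadForm, monomial_mul_monomial, smul_monomial, map_sub,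
        one_add_one_eq_two, ← map_sum]
    rw [h1, Q.commDefect_eq_zero, map_zero]
  have hw (w : List (Fin n)) : f (w.map fun i => q (y i)).prod =
      monomial w.length (w.map fun i => q (y i)).prod := by
    induction w with
    | nil => simp
    | cons i w ih =>
      rw [List.map_cons, List.prod_cons, map_mul, ih, hf, hf₀, monomial_mul_monomial, add_comm]
      rfl
  refine ⟨fun d =>
    { toFun a := (f a).coeff d
      map_add' a b := by rw [map_add, coeff_add]
      map_smul' c a := by rw [map_smul, coeff_smul]; rfl }, fun d w => ?_⟩
  change (f _).coeff d = _
  rw [hw, coeff_monomial]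

end IsQuadraticQuotient

end Presentation

/-! ### The algebra A as a flat deformation -/

section Quadratic

variable {k : Type*} [Field k] {n : ℕ} {α : Fin n → Fin n → Fin n → Fin n → k}

/-- The coefficients `α`, as constant polynomials in `ħ`. -/
def constCoeff (α : Fin n → Fin n → Fin n → Fin n → k) (i j a b : Fin n) : k[X] :=
  C (α i j a b)

theorem isCyclic_constCoeff (hα : ∀ i j a b, α i j a b = -α j i a b)
    (hα₀ : ∀ i a b, α i i a b = 0)
    (hcycl : ∀ i j l b c d, cycl
      (fun i j l => ∑ s, (α j l s b * α i s c d + α j l c s * α i s d b)) i j l = 0) :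
    IsCyclic (constCoeff α) where
  antisymm i j a b := by rw [constCoeff, hα, C_neg, constCoeff]
  self i a b := by rw [constCoeff, hα₀, C_0]
  cyclic i j l a d b := by
    have := congrArg (C : k →+* k[X]) (hcycl i j l b a d)
    simpa only [cycl, map_add, map_sum, map_mul, map_zero, constCoeff] using this

theorem commDefect_ι (i j : Fin n) :
    commDefect (X : k[X]) (constCoeff α) (FreeAlgebra.ι k[X]) i j =
      FreeAlgebra.ι k[X] i * FreeAlgebra.ι k[X] j - FreeAlgebra.ι k[X] j * FreeAlgebra.ι k[X] i -
        quadPhi α i j :=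
  rfl

/-- A quotient of the free algebra over `k[ħ]` by quadratic commutation relations which satisfy the
cyclic identity is a flat deformation of the polynomial ring. -/
theorem IsQuadraticQuotient.polynomialDeformation {A : Type*} [Ring A] [Algebra k[X] A]
    (hc : IsCyclic (constCoeff α)) {q : FreeAlgebra k[X] (Fin n) →ₐ[k[X]] A}
    (Q : IsQuadraticQuotient (X : k[X]) (constCoeff α) (FreeAlgebra.ι k[X]) q) :
    Nonempty (PolynomialDeformation (k := k) fun i => q (FreeAlgebra.ι k[X] i)) := by
  let b := (FreeAlgebra.basisFreeMonoid k[X] (Fin n)).reindex FreeMonoid.toList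
  have hb (w : List (Fin n)) : b w = (w.map (FreeAlgebra.ι k[X])).prod := by
    rw [Module.Basis.reindex_apply]
    exact basisFreeMonoid_ofList k[X] w
  obtain ⟨proj, hproj⟩ := Q.exists_proj fun z =>
    ⟨FreeAlgebra.lift k[X] z, FreeAlgebra.lift_ι_apply z⟩
  -- With ħ acting as 0 the defects become plain commutators, which vanish in S(V).
  let _ : Algebra k[X] (MvPolynomial (Fin n) k) :=
    (MvPolynomial.C.comp (evalRingHom (0 : k))).toAlgebra
  have hX : algebraMap k[X] (MvPolynomial (Fin n) k) X = 0 := by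
    rw [RingHom.algebraMap_toAlgebra]
    simp
  obtain ⟨π, hπ⟩ := Q.exists_lift
    (FreeAlgebra.lift k[X] fun i => (MvPolynomial.X i : MvPolynomial (Fin n) k)) fun i j => by
      rw [commDefect, mul_comm, sub_self, zero_sub, neg_eq_zero, Algebra.smul_def, hX, zero_mul]
  refine ⟨⟨Q.span_words b hb, fun a ha => eq_zero_of_smul_eq_zero b hb hc X_ne_zero q Q.surjective
    Q.map_defect Q.mem_of_map_eq_zero ha, fun i j => ?_, π, fun p => π.commutes p, fun i => ?_, proj,
    hproj⟩⟩
  · exact ⟨_, sub_eq_iff_eq_add'.1 (sub_eq_zero.1 (Q.commDefect_eq_zero i j))⟩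
  · exact (hπ _).trans (FreeAlgebra.lift_ι_apply _ _)

/-- A is presented by the relations with i < j only; the defects alternate, so these generate all
the others. -/
theorem commDefect_mem (hc : IsCyclic (constCoeff α)) (J : TwoSidedIdeal (FreeAlgebra k[X] (Fin n)))
    (hJ : ∀ i j, i < j → commDefect (X : k[X]) (constCoeff α) (FreeAlgebra.ι k[X]) i j ∈ J)
    (i j : Fin n) : commDefect (X : k[X]) (constCoeff α) (FreeAlgebra.ι k[X]) i j ∈ J := by
  obtain h | rfl | h := lt_trichotomy i j
  · exact hJ i j h
  · rw [commDefect_self hc.self]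
    exact zero_mem _
  · rw [commDefect_antisymm hc.antisymm]
    exact neg_mem (hJ j i h)

theorem isQuadraticQuotient_mkAlgHom (hc : IsCyclic (constCoeff α)) :
    IsQuadraticQuotient (A := Alg (quadPhi α)) (X : k[X]) (constCoeff α) (FreeAlgebra.ι k[X])
      (RingQuot.mkAlgHom k[X] (Rel (quadPhi α))) where
  surjective := RingQuot.mkAlgHom_surjective _ _
  map_defect i j := by
    have h1 := commDefect_mem hc (TwoSidedIdeal.ker (RingQuot.mkAlgHom k[X] (Rel (quadPhi α))))
      (fun i j h => by
        rw [TwoSidedIdeal.mem_ker, commDefect_ι, RingQuot.mkAlgHom_rel k[X] (Rel.comm i j h),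
          map_zero]) i j
    exact (TwoSidedIdeal.mem_ker _).1 h1
  mem_of_map_eq_zero t ht J hJ := by
    refine mem_of_mkAlgHom_eq_zero J (fun a b hab => ?_) ht
    obtain ⟨i, j, -⟩ := hab
    rw [sub_zero]
    exact hJ i j

end Quadratic

/-! ### Specialization at ħ = c -/

section Fibre

variable {k : Type*} [Field k] {A : Type*} [Ring A] [Algebra k[X] A]

/-- The kernel of `A → k[ħ]/(ħ - c) ⊗ A` is `(ħ - c) A`. -/
theorem exists_eq_smul_of_one_tmul_eq_zero {c : k} {a : A}
    (ha : (1 : k[X] ⧸ Ideal.span {X - C c}) ⊗ₜ[k[X]] a = 0) : ∃ e, a = (X - C c) • e := by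
  have h1 := congrArg (TensorProduct.quotTensorEquivQuotSMul A (Ideal.span {X - C c})) ha
  have h2 := TensorProduct.quotTensorEquivQuotSMul_mk_tmul (Ideal.span {X - C c}) (1 : k[X]) a
  rw [one_smul] at h2
  have h3 := h2.symm.trans (h1.trans (map_zero _))
  rw [Submodule.Quotient.mk_eq_zero, Submodule.ideal_span_singleton_smul] at h3
  obtain ⟨e, -, he⟩ := h3
  exact ⟨e, he.symm⟩

theorem algebraMap_fibre (c : k) (p : k[X]) :
    (1 : k[X] ⧸ Ideal.span {X - C c}) ⊗ₜ[k[X]] algebraMap k[X] A p =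
      algebraMap k ((k[X] ⧸ Ideal.span {X - C c}) ⊗[k[X]] A) (p.eval c) := by
  have h1 : (Ideal.Quotient.mk (Ideal.span {X - C c})) p =
      algebraMap k (k[X] ⧸ Ideal.span {X - C c}) (p.eval c) := by
    refine Ideal.Quotient.eq.2 (Ideal.mem_span_singleton.2 ?_)
    exact X_sub_C_dvd_sub_C_eval
  rw [Algebra.TensorProduct.algebraMap_apply, ← h1, Algebra.algebraMap_eq_smul_one,
    TensorProduct.tmul_smul, TensorProduct.smul_tmul']
  exact congrArg (· ⊗ₜ[k[X]] (1 : A))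
    (Algebra.algebraMap_eq_smul_one (A := k[X] ⧸ Ideal.span {X - C c}) p).symm

theorem PolynomialDeformation.isPBW_of_map {B : Type*} [Ring B] [Algebra k B] {n : ℕ} {x : Fin n → A}
    (D : PolynomialDeformation (k := k) x) {c : k} (hc : c ∉ exceptionalSet k A) (f : A → B)
    (hone : f 1 = 1) (hmul : ∀ a b, f (a * b) = f a * f b) (hadd : ∀ a b, f (a + b) = f a + f b)
    (hf : ∀ p : k[X], f (algebraMap k[X] A p) = algebraMap k B (p.eval c))
    (hker : ∀ a, f a = 0 → ∃ e, a = (X - C c) • e) : IsPBW k fun i => f (x i) :=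
  D.isPBW (RingHom.mk' ⟨⟨f, hone⟩, hmul⟩ hadd) hf hker hc

theorem PolynomialDeformation.isPBW_fibre {n : ℕ} {x : Fin n → A}
    (D : PolynomialDeformation (k := k) x) {c : k} (hc : c ∉ exceptionalSet k A) :
    IsPBW k fun i => (1 : k[X] ⧸ Ideal.span {X - C c}) ⊗ₜ[k[X]] x i := by
  refine D.isPBW_of_map hc (fun a => (1 : k[X] ⧸ Ideal.span {X - C c}) ⊗ₜ[k[X]] a) ?_ ?_ ?_ ?_ ?_
  · rfl
  · exact fun a b => ((Algebra.TensorProduct.tmul_mul_tmul 1 1 a b).trans (by rw [mul_one])).symm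
  · exact fun a b => TensorProduct.tmul_add _ _ _
  · exact algebraMap_fibre c
  · exact fun _ => exists_eq_smul_of_one_tmul_eq_zero

end Fibre

end QuadraticPBW
end

theorem mainTheorem4 {k : Type*} [Field k] {n : ℕ}
    (α : Fin n → Fin n → Fin n → Fin n → k)
    (hα : ∀ i j a b, α i j a b = -α j i a b)
    (hα₀ : ∀ i a b, α i i a b = 0)
    (hcycl : ∀ i j l b c d, QuadraticPBW.cycl
      (fun i j l => ∑ s, (α j l s b * α i s c d + α j l c s * α i s d b)) i j l = 0) :
    QuadraticPBW.DescendingPBW k (QuadraticPBW.Alg (QuadraticPBW.quadPhi α)) n ∧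
    (QuadraticPBW.exceptionalSet k (QuadraticPBW.Alg (QuadraticPBW.quadPhi α))).Countable ∧
    ∀ a ∉ QuadraticPBW.exceptionalSet k (QuadraticPBW.Alg (QuadraticPBW.quadPhi α)),
      QuadraticPBW.IsPBW k (QuadraticPBW.specGen (QuadraticPBW.quadPhi α) a) := by
  have hc := QuadraticPBW.isCyclic_constCoeff hα hα₀ hcycl
  obtain ⟨D⟩ := (QuadraticPBW.isQuadraticQuotient_mkAlgHom hc).polynomialDeformation hc
  exact ⟨D.descendingPBW, D.countable_exceptionalSet, fun a ha => D.isPBW_fibre ha⟩
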